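/- Let $S_1,S_2$ be finite sets and let $A\in\mathbb R^{S_1\times S_2}$ be a matrix whose entries are pairwise distinct. Consider the 2-agent zero-sum game in which agent 1 has payoff matrix $A$ and agent 2 has payoff matrix $-A^{\mathsf T}$. Let $\mathcal X=\mathcal X_1\times\mathcal X_2$, where $\mathcal X_i$ is the simplex of probability vectors on $S_i$. Stochastic Multiplicative Weights Update (MWU) with learning rates $\eta_1,\eta_2$ is the Markov chain on $\mathcal X$ that moves as follows from a state $x=(x_1,x_2)$: pure strategies $s_1\sim x_1$ and $s_2\sim x_2$ are drawn independently, and the new state $x'=(x_1',x_2')$ is $$x'_{1a}=\frac{x_{1a}\,e^{\eta_1 A_{a s_2}}}{\sum_{b\in S_1}x_{1b}\,e^{\eta_1 A_{b s_2}}}\quad(a\in S_1),\qquad x'_{2a}=\frac{x_{2a}\,e^{-\eta_2 A_{s_1 a}}}{\sum_{b\in S_2}x_{2b}\,e^{-\eta_2 A_{s_1 b}}}\quad(a\in S_2).$$ Let $X^t$ denote the law (a Borel probability measure on $\mathcal X$) of this chain at time $t$, started from an arbitrary initial law $X^0$, and let $\bar X^T=\frac1T\sum_{t=1}^T X^t$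 for $T\ge 1$. Then there is an $\eta_0>0$, depending only on $A$, such that for all learning rates $0<\eta_1,\eta_2<\eta_0$ (in particular for a common rate $\eta_1=\eta_2=\eta$) and every initial law $X^0$: 1. the sequence $(\bar X^T)_{T\ge1}$ has a weakly convergent subsequence; 2. every weak limit of a subsequence of $(\bar X^T)_{T\ge1}$ is a mixture of pure strategy profiles, i.e. a convex combination $\sum_{s\in S_1\times S_2}w_s\,\delta_{(e_{s_1},e_{s_2})}$ of point masses at pure strategy profiles. -/

import Mathlib

open MeasureTheory ProbabilityTheory Filter Topology
open scoped NNReal ENNReal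

/-- Profiles of mixed strategies of the two agents, i.e. the set `𝒳 = 𝒳₁ × 𝒳₂`, a product of two
probability simplices, with its usual topology and Borel σ-algebra. -/
abbrev MixedProfile (S₁ S₂ : Type*) [Fintype S₁] [Fintype S₂] : Type _ :=
  stdSimplex ℝ S₁ × stdSimplex ℝ S₂

/-- The pure strategy profile `(e_{s₁}, e_{s₂})`. -/
noncomputable def pureProfile {S₁ S₂ : Type*} [Fintype S₁] [Fintype S₂]
    (s : S₁ × S₂) : MixedProfile S₁ S₂ := by
  classical exact (stdSimplex.vertex s.1, stdSimplex.vertex s.2)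

theorem mwu_denom_pos {S : Type*} [Fintype S] (w : S → ℝ) (x : stdSimplex ℝ S) :
    0 < ∑ a, x a * Real.exp (w a) := by
  have h0 : ∀ a, 0 ≤ x a := fun a => x.2.1 a
  have h1 : ∑ a, x a = 1 := x.2.2
  refine lt_of_le_of_ne (Finset.sum_nonneg fun a _ => mul_nonneg (h0 a) (Real.exp_pos _).le) ?_
  intro h
  have h2 := (Finset.sum_eq_zero_iff_of_nonneg
    (fun a _ => mul_nonneg (h0 a) (Real.exp_pos (w a)).le)).1 h.symm
  have h3 : ∑ a, x a = 0 := Finset.sum_eq_zero fun a ha =>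
    (mul_eq_zero.1 (h2 a ha)).resolve_right (Real.exp_pos _).ne'
  linarith

/-- One multiplicative weights step of a single agent with learning rate `η`, current mixed strategy
`x` and payoff vector `u`:  `x_a ↦ x_a exp (η u_a) / ∑_b x_b exp (η u_b)`. -/
noncomputable def mwuStep {S : Type*} [Fintype S] (η : ℝ) (u : S → ℝ) (x : stdSimplex ℝ S) :
    stdSimplex ℝ S :=
  ⟨fun a => x a * Real.exp (η * u a) / ∑ b, x b * Real.exp (η * u b), by
    have hpos := mwu_denom_pos (fun a => η * u a) x
    refine ⟨fun a => div_nonneg (mul_nonneg (x.2.1 a) (Real.exp_pos _).le) hpos.le, ?_⟩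
    rw [← Finset.sum_div]
    exact div_self hpos.ne'⟩

/-- The profile that follows `x` when the pure profile `s` is realized: agent 1 has payoff matrix
`A` and sees the payoff vector `A e_{s₂}`, agent 2 has payoff matrix `-Aᵀ` and sees `-Aᵀ e_{s₁}`.
The learning rates are `η₁` and `η₂`. -/
noncomputable def mwuUpdate {S₁ S₂ : Type*} [Fintype S₁] [Fintype S₂]
    (A : Matrix S₁ S₂ ℝ) (η₁ η₂ : ℝ) (s : S₁ × S₂) (x : MixedProfile S₁ S₂) :
    MixedProfile S₁ S₂ :=
  (mwuStep η₁ (fun a => A a s.2) x.1, mwuStep η₂ (fun b => (-A.transpose) b s.1) x.2)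

theorem continuous_coord {S : Type*} [Fintype S] (a : S) :
    Continuous fun x : stdSimplex ℝ S => x a :=
  (continuous_apply a).comp continuous_subtype_val

theorem continuous_mwuStep {S : Type*} [Fintype S] (η : ℝ) (u : S → ℝ) :
    Continuous (mwuStep η u) := by
  refine Continuous.subtype_mk (continuous_pi fun a => ?_) _
  refine Continuous.div ((continuous_coord a).mul continuous_const)
    (continuous_finsetSum _ fun b _ => (continuous_coord b).mul continuous_const) ?_
  exact fun x => (mwu_denom_pos (fun b => η * u b) x).ne'

theorem continuous_mwuUpdate {S₁ S₂ : Type*} [Fintype S₁] [Fintype S₂]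
    (A : Matrix S₁ S₂ ℝ) (η₁ η₂ : ℝ) (s : S₁ × S₂) : Continuous (mwuUpdate A η₁ η₂ s) :=
  ((continuous_mwuStep _ _).comp continuous_fst).prodMk
    ((continuous_mwuStep _ _).comp continuous_snd)

/-- The transition kernel of stochastic MWU on the space of mixed profiles: from `x`, the agents
independently draw pure strategies `s₁ ∼ x₁`, `s₂ ∼ x₂`, and move to `mwuUpdate A η₁ η₂ s x`. -/
noncomputable def mwuKernel {S₁ S₂ : Type*} [Fintype S₁] [Fintype S₂]
    (A : Matrix S₁ S₂ ℝ) (η₁ η₂ : ℝ) : Kernel (MixedProfile S₁ S₂) (MixedProfile S₁ S₂) where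
  toFun x := ∑ s : S₁ × S₂,
    ENNReal.ofReal (x.1 s.1 * x.2 s.2) • Measure.dirac (mwuUpdate A η₁ η₂ s x)
  measurable' := by
    refine Measure.measurable_of_measurable_coe _ fun B hB => ?_
    simp only [Measure.coe_finsetSum, Finset.sum_apply, Measure.smul_apply, smul_eq_mul]
    refine Finset.measurable_sum _ fun s _ => ?_
    refine Measurable.mul ?_ ?_
    · exact (((continuous_coord s.1).comp continuous_fst).mul
        ((continuous_coord s.2).comp continuous_snd)).measurable.ennreal_ofReal
    · simp only [Measure.dirac_apply' _ hB]
      exact (measurable_one.indicator hB).comp (continuous_mwuUpdate A η₁ η₂ s).measurable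

instance instIsMarkovKernelMwuKernel {S₁ S₂ : Type*} [Fintype S₁] [Fintype S₂] (A : Matrix S₁ S₂ ℝ) (η₁ η₂ : ℝ) :
    IsMarkovKernel (mwuKernel A η₁ η₂) := by
  refine ⟨fun x => ⟨?_⟩⟩
  have h1 : ∑ a, x.1 a = 1 := x.1.2.2
  have h2 : ∑ b, x.2 b = 1 := x.2.2.2
  change (∑ s : S₁ × S₂, ENNReal.ofReal (x.1 s.1 * x.2 s.2) •
    Measure.dirac (mwuUpdate A η₁ η₂ s x)) Set.univ = 1
  simp only [Measure.coe_finsetSum, Finset.sum_apply, Measure.smul_apply, smul_eq_mul,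
    measure_univ, mul_one]
  rw [← ENNReal.ofReal_sum_of_nonneg fun s _ => mul_nonneg (x.1.2.1 s.1) (x.2.2.1 s.2),
    Fintype.sum_prod_type]
  simp only [← Finset.mul_sum, h2, mul_one, h1, ENNReal.ofReal_one]

/-- The law `X^t` of the mixed profile of stochastic MWU at time `t`, for the initial law `μ`:
`X^0 = μ`, `X^{t+1} = X^t P` with `P` the transition kernel. -/
noncomputable def mwuLaw {S₁ S₂ : Type*} [Fintype S₁] [Fintype S₂]
    (A : Matrix S₁ S₂ ℝ) (η₁ η₂ : ℝ) (μ : ProbabilityMeasure (MixedProfile S₁ S₂)) :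
    ℕ → ProbabilityMeasure (MixedProfile S₁ S₂)
  | 0 => μ
  | t + 1 => ⟨(mwuLaw A η₁ η₂ μ t : Measure (MixedProfile S₁ S₂)).bind (mwuKernel A η₁ η₂),
      inferInstance⟩

/-- The time average `X̄^T = (1/T) ∑_{t=1}^T X^t` of the laws, for `T ≥ 1`. -/
noncomputable def mwuTimeAverage {S₁ S₂ : Type*} [Fintype S₁] [Fintype S₂]
    (A : Matrix S₁ S₂ ℝ) (η₁ η₂ : ℝ) (μ : ProbabilityMeasure (MixedProfile S₁ S₂)) (T : ℕ+) :
    ProbabilityMeasure (MixedProfile S₁ S₂) :=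
  ⟨((T : ℕ) : ℝ≥0∞)⁻¹ • ∑ t ∈ Finset.Icc 1 (T : ℕ),
      (mwuLaw A η₁ η₂ μ t : Measure (MixedProfile S₁ S₂)), by
    refine ⟨?_⟩
    simp only [Measure.smul_apply, Measure.coe_finsetSum, Finset.sum_apply, measure_univ,
      Finset.sum_const, Nat.card_Icc, Nat.add_sub_cancel, smul_eq_mul, nsmul_eq_mul, mul_one]
    exact ENNReal.inv_mul_cancel (by exact_mod_cast T.ne_zero) (ENNReal.natCast_ne_top _)⟩

/-- A law on mixed profiles is a mixture of pure strategy profiles if it is a convex combination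
`∑_s w_s δ_{(e_{s₁}, e_{s₂})}` of point masses at pure strategy profiles. -/
def IsMixtureOfPure {S₁ S₂ : Type*} [Fintype S₁] [Fintype S₂]
    (π : ProbabilityMeasure (MixedProfile S₁ S₂)) : Prop :=
  ∃ w : S₁ × S₂ → ℝ≥0, ∑ s, w s = 1 ∧
    (π : Measure (MixedProfile S₁ S₂)) = ∑ s, w s • Measure.dirac (pureProfile s)

/-! The state space is compact and the one-step expectation `mwuMean` preserves continuity, so the
time averages have weak limits, and each limit is an invariant law of the chain (the
Krylov–Bogoliubov argument). It remains to show that an invariant law only charges pure profiles.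

An update never changes supports, so the state space splits into finitely many invariant open faces,
indexed by supports `U`, `V`. By `measure_eq_zero_of_drift_pos`, a face is null as soon as some
function on it has bounded increments and positive drift. On every face other than a vertex, a
weighted sum of log-probabilities is such a function (`measure_openFace_eq_zero`). Stiemke's
alternative supplies the weights: if a zero-sum combination of one agent's strategies on the face
weakly dominates, the log-normalizers cancel and the drift is the positive payoff advantage;
otherwise the subgame on `U × V` has a fully mixed equilibrium, and the function is the
cross-entropy relative to it, with each agent's part divided by that agent's rate. The zero-sum
property cancels the payoff terms in its drift. What remains is a sum of Jensen gaps of log-sum-exp,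
strictly positive because the entries of `A` are distinct. -/

/-! ### The transition operator and invariant measures -/

section Transition

variable {S₁ S₂ : Type*} [Fintype S₁] [Fintype S₂] (A : Matrix S₁ S₂ ℝ) (η₁ η₂ : ℝ)

/-- The expectation of `f` after one step of stochastic MWU from `x`. -/
noncomputable def mwuMean (f : MixedProfile S₁ S₂ → ℝ) (x : MixedProfile S₁ S₂) : ℝ :=
  ∑ s : S₁ × S₂, x.1 s.1 * x.2 s.2 * f (mwuUpdate A η₁ η₂ s x)

theorem MixedProfile.sum_weight (x : MixedProfile S₁ S₂) :
    ∑ s : S₁ × S₂, x.1 s.1 * x.2 s.2 = 1 := by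
  have h1 : ∑ a, x.1 a = 1 := x.1.2.2
  have h2 : ∑ b, x.2 b = 1 := x.2.2.2
  rw [Fintype.sum_prod_type]
  simp only [← Finset.mul_sum, h2, mul_one, h1]

theorem MixedProfile.weight_nonneg (x : MixedProfile S₁ S₂) (s : S₁ × S₂) :
    0 ≤ x.1 s.1 * x.2 s.2 := mul_nonneg (x.1.2.1 s.1) (x.2.2.1 s.2)

theorem continuous_weight (s : S₁ × S₂) :
    Continuous fun x : MixedProfile S₁ S₂ => x.1 s.1 * x.2 s.2 :=
  ((continuous_coord s.1).comp continuous_fst).mul ((continuous_coord s.2).comp continuous_snd)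

theorem continuous_mwuMean {f : MixedProfile S₁ S₂ → ℝ} (hf : Continuous f) :
    Continuous (mwuMean A η₁ η₂ f) :=
  continuous_finsetSum _ fun s _ =>
    (continuous_weight s).mul (hf.comp (continuous_mwuUpdate A η₁ η₂ s))

theorem measurable_mwuMean {f : MixedProfile S₁ S₂ → ℝ} (hf : Measurable f) :
    Measurable (mwuMean A η₁ η₂ f) :=
  Finset.measurable_fun_sum _ fun s _ => (continuous_weight s).measurable.mul
    (hf.comp (continuous_mwuUpdate A η₁ η₂ s).measurable)

theorem integral_mwuKernel (f : MixedProfile S₁ S₂ → ℝ) (x : MixedProfile S₁ S₂) :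
    ∫ y, f y ∂(mwuKernel A η₁ η₂ x) = mwuMean A η₁ η₂ f x := by
  change ∫ y, f y ∂(∑ s : S₁ × S₂,
    ENNReal.ofReal (x.1 s.1 * x.2 s.2) • Measure.dirac (mwuUpdate A η₁ η₂ s x)) = _
  rw [integral_finsetSum_measure]
  · refine Finset.sum_congr rfl fun s _ => ?_
    rw [integral_smul_measure, integral_dirac, ENNReal.toReal_ofReal (x.weight_nonneg s),
      smul_eq_mul]
  · exact fun s _ => (integrable_dirac (by finiteness)).smul_measure ENNReal.ofReal_ne_top

theorem integral_bind_mwuKernel (ν : Measure (MixedProfile S₁ S₂)) [IsProbabilityMeasure ν]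
    {f : MixedProfile S₁ S₂ → ℝ} (hf : Measurable f) {C : ℝ} (hC : ∀ x, |f x| ≤ C) :
    ∫ y, f y ∂(ν.bind (mwuKernel A η₁ η₂)) = ∫ x, mwuMean A η₁ η₂ f x ∂ν := by
  have hint : Integrable f (ν.bind (mwuKernel A η₁ η₂)) :=
    Integrable.of_bound hf.aestronglyMeasurable C (ae_of_all _ hC)
  rw [Measure.comp_eq_comp_const_apply] at hint ⊢
  rw [Kernel.integral_comp hint]
  simp only [integral_mwuKernel, Kernel.const_apply]

theorem integral_mwuLaw_succ (μ : ProbabilityMeasure (MixedProfile S₁ S₂)) (t : ℕ)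
    {f : MixedProfile S₁ S₂ → ℝ} (hf : Measurable f) {C : ℝ} (hC : ∀ x, |f x| ≤ C) :
    ∫ y, f y ∂(mwuLaw A η₁ η₂ μ (t + 1) : Measure (MixedProfile S₁ S₂)) =
      ∫ x, mwuMean A η₁ η₂ f x ∂(mwuLaw A η₁ η₂ μ t : Measure (MixedProfile S₁ S₂)) :=
  integral_bind_mwuKernel A η₁ η₂ _ hf hC

theorem integral_mwuTimeAverage (μ : ProbabilityMeasure (MixedProfile S₁ S₂)) (T : ℕ+)
    {f : MixedProfile S₁ S₂ → ℝ} (hf : Continuous f) :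
    ∫ y, f y ∂(mwuTimeAverage A η₁ η₂ μ T : Measure (MixedProfile S₁ S₂)) =
      (T : ℝ)⁻¹ * ∑ t ∈ Finset.Icc 1 (T : ℕ),
        ∫ y, f y ∂(mwuLaw A η₁ η₂ μ t : Measure (MixedProfile S₁ S₂)) := by
  change ∫ y, f y ∂(((T : ℕ) : ℝ≥0∞)⁻¹ • ∑ t ∈ Finset.Icc 1 (T : ℕ),
      (mwuLaw A η₁ η₂ μ t : Measure (MixedProfile S₁ S₂))) = _
  rw [integral_smul_measure, integral_finsetSum_measure]
  · simp
  · exact fun t _ => hf.integrable_of_hasCompactSupport (HasCompactSupport.of_compactSpace f)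

/-- Applying the kernel shifts the average by one time step, so the difference telescopes to the two
boundary terms, divided by `T`. -/
theorem integral_mwuMean_timeAverage_sub (μ : ProbabilityMeasure (MixedProfile S₁ S₂)) (T : ℕ+)
    {f : MixedProfile S₁ S₂ → ℝ} (hf : Continuous f) {C : ℝ} (hC : ∀ x, |f x| ≤ C) :
    |∫ y, mwuMean A η₁ η₂ f y ∂(mwuTimeAverage A η₁ η₂ μ T : Measure (MixedProfile S₁ S₂)) -
      ∫ y, f y ∂(mwuTimeAverage A η₁ η₂ μ T : Measure (MixedProfile S₁ S₂))| ≤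
        (T : ℝ)⁻¹ * (2 * C) := by
  rw [integral_mwuTimeAverage A η₁ η₂ μ T hf,
    integral_mwuTimeAverage A η₁ η₂ μ T (continuous_mwuMean A η₁ η₂ hf), ← mul_sub,
    ← Finset.sum_sub_distrib]
  simp only [← integral_mwuLaw_succ A η₁ η₂ μ _ hf.measurable hC]
  have htel : ∀ (u : ℕ → ℝ) (n : ℕ), ∑ t ∈ Finset.Icc 1 n, (u (t + 1) - u t) =
      u (n + 1) - u 1 := by
    intro u n
    induction n with
    | zero => simp
    | succ n ih => rw [Finset.sum_Icc_succ_top (by omega), ih]; ring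
  rw [htel fun t => ∫ y, f y ∂(mwuLaw A η₁ η₂ μ t : Measure (MixedProfile S₁ S₂)), abs_mul,
    abs_of_nonneg (by positivity : (0 : ℝ) ≤ (T : ℝ)⁻¹)]
  have hb : ∀ t, |∫ y, f y ∂(mwuLaw A η₁ η₂ μ t : Measure (MixedProfile S₁ S₂))| ≤ C := fun t => by
    have := norm_integral_le_of_norm_le_const (f := f) (C := C)
      (μ := (mwuLaw A η₁ η₂ μ t : Measure (MixedProfile S₁ S₂))) (ae_of_all _ fun x => hC x)
    simpa using this
  gcongr
  have h1 := abs_le.1 (hb (T + 1))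
  have h2 := abs_le.1 (hb 1)
  rw [abs_le]
  constructor <;> linarith

/-- Weak limits of time averages of stochastic MWU are invariant. -/
theorem bind_mwuKernel_eq_of_tendsto (μ π : ProbabilityMeasure (MixedProfile S₁ S₂))
    {φ : ℕ → ℕ+} (hφ : StrictMono φ)
    (h : Tendsto (fun n => mwuTimeAverage A η₁ η₂ μ (φ n)) atTop (𝓝 π)) :
    (π : Measure (MixedProfile S₁ S₂)).bind (mwuKernel A η₁ η₂) = π := by
  rw [ProbabilityMeasure.tendsto_iff_forall_integral_tendsto] at h
  refine ext_of_forall_integral_eq_of_IsFiniteMeasure fun f => ?_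
  have hC : ∀ x, |f x| ≤ ‖f‖ := f.norm_coe_le_norm
  rw [integral_bind_mwuKernel A η₁ η₂ _ f.continuous.measurable hC]
  have h1 := h f
  have h2 := h (BoundedContinuousFunction.mkOfCompact
    ⟨mwuMean A η₁ η₂ f, continuous_mwuMean A η₁ η₂ f.continuous⟩)
  have h3 := h2.sub h1
  simp only [BoundedContinuousFunction.mkOfCompact_apply, ContinuousMap.coe_mk] at h3
  have hφ' : Tendsto (fun n => ((φ n : ℕ) : ℝ)⁻¹ * (2 * ‖f‖)) atTop (𝓝 0) := by
    have hN : Tendsto (fun n => (φ n : ℕ)) atTop atTop :=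
      StrictMono.tendsto_atTop fun a b hab => PNat.coe_lt_coe _ _ |>.2 (hφ hab)
    have := (tendsto_inv_atTop_zero.comp (tendsto_natCast_atTop_atTop (R := ℝ))).comp hN
    simpa using this.mul_const (2 * ‖f‖)
  have h4 := squeeze_zero_norm (fun n => (Real.norm_eq_abs _).trans_le <|
    integral_mwuMean_timeAverage_sub A η₁ η₂ μ (φ n) f.continuous hC) hφ'
  exact sub_eq_zero.1 (tendsto_nhds_unique h3 h4)

/-- An invariant probability measure gives no mass to an invariant set on which some function with
bounded increments has positive drift. -/
theorem measure_eq_zero_of_drift_pos {ν : Measure (MixedProfile S₁ S₂)} [IsProbabilityMeasure ν]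
    (hν : ν.bind (mwuKernel A η₁ η₂) = ν) {F : Set (MixedProfile S₁ S₂)} (hF : MeasurableSet F)
    (hFinv : ∀ s x, mwuUpdate A η₁ η₂ s x ∈ F ↔ x ∈ F) {W : MixedProfile S₁ S₂ → ℝ}
    (hW : Measurable W) {C : ℝ} (hC : ∀ x ∈ F, ∀ s, |W (mwuUpdate A η₁ η₂ s x) - W x| ≤ C)
    (hpos : ∀ x ∈ F, 0 < mwuMean A η₁ η₂ W x - W x) : ν F = 0 := by
  classical
  rcases F.eq_empty_or_nonempty with rfl | ⟨x₀, hx₀⟩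
  · simp
  have hs₀ : Nonempty (S₁ × S₂) := by
    by_contra hne
    rw [not_nonempty_iff] at hne
    simpa using x₀.sum_weight
  have hC0 : 0 ≤ C := (abs_nonneg _).trans (hC x₀ hx₀ hs₀.some)
  -- `W` may be unbounded and not integrable, so invariance cannot be applied to it directly.
  -- Truncation makes it integrable, and as `clamp n` is 1-Lipschitz the bound `C` on increments
  -- survives, which gives a dominating function uniform in `n`.
  let clamp : ℕ → ℝ → ℝ := fun n r => max (min r n) (-n)
  have hclampM : ∀ n, Measurable (clamp n) := fun n => by fun_prop
  have hclampB : ∀ n r, |clamp n r| ≤ n := fun n r => by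
    have : (0 : ℝ) ≤ n := n.cast_nonneg
    exact abs_le.2 ⟨le_max_right _ _, max_le (min_le_right _ _) (by linarith)⟩
  have hclampL : ∀ n r r', |clamp n r - clamp n r'| ≤ |r - r'| := fun n r r' =>
    (abs_max_sub_max_le_abs _ _ _).trans ((abs_min_sub_min_le_max _ _ _ _).trans (by simp))
  have hclampE : ∀ r, ∀ᶠ n in atTop, clamp n r = r := fun r => by
    obtain ⟨N, hN⟩ := exists_nat_ge |r|
    filter_upwards [eventually_ge_atTop N] with n hn
    have h1 : |r| ≤ n := hN.trans (by exact_mod_cast hn)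
    have h2 := abs_le.1 h1
    simp only [clamp]
    rw [min_eq_left h2.2, max_eq_left h2.1]
  let g : ℕ → MixedProfile S₁ S₂ → ℝ := fun n => F.indicator fun x => clamp n (W x)
  have hgM : ∀ n, Measurable (g n) := fun n => ((hclampM n).comp hW).indicator hF
  have hgB : ∀ n x, |g n x| ≤ n := fun n x => by
    by_cases hx : x ∈ F
    · simpa [g, hx] using hclampB n (W x)
    · simp [g, hx]
  have hint0 : ∀ n, ∫ x, (mwuMean A η₁ η₂ (g n) x - g n x) ∂ν = 0 := fun n => by
    have hmB : ∀ x, |mwuMean A η₁ η₂ (g n) x| ≤ n := fun x => by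
      calc |mwuMean A η₁ η₂ (g n) x|
          ≤ ∑ s : S₁ × S₂, |x.1 s.1 * x.2 s.2 * g n (mwuUpdate A η₁ η₂ s x)| :=
            Finset.abs_sum_le_sum_abs _ _
        _ ≤ ∑ s : S₁ × S₂, x.1 s.1 * x.2 s.2 * n := by
            refine Finset.sum_le_sum fun s _ => ?_
            rw [abs_mul, abs_of_nonneg (x.weight_nonneg s)]
            exact mul_le_mul_of_nonneg_left (hgB n _) (x.weight_nonneg s)
        _ = n := by rw [← Finset.sum_mul, x.sum_weight, one_mul]
    rw [integral_sub, ← integral_bind_mwuKernel A η₁ η₂ ν (hgM n) (hgB n), hν, sub_self]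
    · exact Integrable.of_bound (measurable_mwuMean A η₁ η₂ (hgM n)).aestronglyMeasurable _
        (ae_of_all _ hmB)
    · exact Integrable.of_bound (hgM n).aestronglyMeasurable _ (ae_of_all _ (hgB n))
  let D : MixedProfile S₁ S₂ → ℝ := F.indicator fun x => mwuMean A η₁ η₂ W x - W x
  have hD : ∀ (V : MixedProfile S₁ S₂ → ℝ) x, mwuMean A η₁ η₂ V x - V x =
      ∑ s : S₁ × S₂, x.1 s.1 * x.2 s.2 * (V (mwuUpdate A η₁ η₂ s x) - V x) := fun V x => by
    simp only [mul_sub, Finset.sum_sub_distrib, ← Finset.sum_mul, x.sum_weight, one_mul]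
    rfl
  -- For fixed `x` only finitely many values of `W` occur, so the truncated drift equals the true
  -- drift once `n` is large. Off `F` both vanish, since the complement of `F` is invariant too.
  have hlim : Tendsto (fun n => ∫ x, (mwuMean A η₁ η₂ (g n) x - g n x) ∂ν) atTop
      (𝓝 (∫ x, D x ∂ν)) := by
    refine tendsto_integral_of_dominated_convergence (fun _ => C)
      (fun n => ((measurable_mwuMean A η₁ η₂ (hgM n)).sub (hgM n)).aestronglyMeasurable)
      (integrable_const C) (fun n => ae_of_all _ fun x => ?_) (ae_of_all _ fun x => ?_)
    · rw [hD, Real.norm_eq_abs]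
      calc |∑ s : S₁ × S₂, x.1 s.1 * x.2 s.2 * (g n (mwuUpdate A η₁ η₂ s x) - g n x)|
          ≤ ∑ s : S₁ × S₂, |x.1 s.1 * x.2 s.2 * (g n (mwuUpdate A η₁ η₂ s x) - g n x)| :=
            Finset.abs_sum_le_sum_abs _ _
        _ ≤ ∑ s : S₁ × S₂, x.1 s.1 * x.2 s.2 * C := by
            refine Finset.sum_le_sum fun s _ => ?_
            rw [abs_mul, abs_of_nonneg (x.weight_nonneg s)]
            refine mul_le_mul_of_nonneg_left ?_ (x.weight_nonneg s)
            by_cases hx : x ∈ F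
            · simp only [g, Set.indicator_of_mem hx, Set.indicator_of_mem ((hFinv s x).2 hx)]
              exact (hclampL _ _ _).trans (hC x hx s)
            · have hx' : mwuUpdate A η₁ η₂ s x ∉ F := fun h => hx ((hFinv s x).1 h)
              simpa [g, hx, hx'] using hC0
        _ = C := by rw [← Finset.sum_mul, x.sum_weight, one_mul]
    · by_cases hx : x ∈ F
      · refine tendsto_const_nhds.congr' ?_
        have hall : ∀ᶠ n in atTop, ∀ s : S₁ × S₂,
            clamp n (W (mwuUpdate A η₁ η₂ s x)) = W (mwuUpdate A η₁ η₂ s x) :=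
          eventually_all.2 fun s => hclampE _
        filter_upwards [hall, hclampE (W x)] with n h1 h2
        simp only [D, Set.indicator_of_mem hx]
        rw [hD, hD]
        refine Finset.sum_congr rfl fun s _ => ?_
        simp only [g, Set.indicator_of_mem hx, Set.indicator_of_mem ((hFinv s x).2 hx), h1 s, h2]
      · refine tendsto_const_nhds.congr fun n => ?_
        have hx' : ∀ s, mwuUpdate A η₁ η₂ s x ∉ F := fun s h => hx ((hFinv s x).1 h)
        simp [D, g, mwuMean, hx, hx']
  simp only [hint0] at hlim
  have hD0 : ∫ x, D x ∂ν = 0 := tendsto_nhds_unique hlim tendsto_const_nhds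
  have hDnn : 0 ≤ D := fun x => Set.indicator_nonneg (fun y hy => (hpos y hy).le) x
  have hDint : Integrable D ν := by
    refine Integrable.of_bound
      (((measurable_mwuMean A η₁ η₂ hW).sub hW).indicator hF).aestronglyMeasurable C
      (ae_of_all _ fun x => ?_)
    by_cases hx : x ∈ F
    · simp only [D, Set.indicator_of_mem hx]
      rw [hD, Real.norm_eq_abs]
      calc |∑ s : S₁ × S₂, x.1 s.1 * x.2 s.2 * (W (mwuUpdate A η₁ η₂ s x) - W x)|
          ≤ ∑ s : S₁ × S₂, |x.1 s.1 * x.2 s.2 * (W (mwuUpdate A η₁ η₂ s x) - W x)| :=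
            Finset.abs_sum_le_sum_abs _ _
        _ ≤ ∑ s : S₁ × S₂, x.1 s.1 * x.2 s.2 * C := by
            refine Finset.sum_le_sum fun s _ => ?_
            rw [abs_mul, abs_of_nonneg (x.weight_nonneg s)]
            exact mul_le_mul_of_nonneg_left (hC x hx s) (x.weight_nonneg s)
        _ = C := by rw [← Finset.sum_mul, x.sum_weight, one_mul]
    · simpa [D, hx] using hC0
  have hae := (integral_eq_zero_iff_of_nonneg hDnn hDint).1 hD0
  refine measure_mono_null (fun x hx => ?_) (ae_iff.1 hae)
  simpa [D, hx] using (hpos x hx).ne'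

end Transition

/-! ### A theorem of the alternative -/

/-- Stiemke's theorem of the alternative for the submatrix of `A` with rows `U` and columns `V`. -/
theorem exists_sum_eq_zero_or_exists_equalizer {S₁ S₂ : Type*} [Fintype S₁] [Fintype S₂]
    (A : Matrix S₁ S₂ ℝ) (U : Finset S₁) (V : Finset S₂) :
    (∃ p : S₂ → ℝ, (∀ b ∉ V, p b = 0) ∧ ∑ b, p b = 0 ∧ (∀ a ∈ U, 0 ≤ ∑ b, A a b * p b) ∧
      ∃ a ∈ U, 0 < ∑ b, A a b * p b) ∨
    ∃ y : S₁ → ℝ, (∀ a ∈ U, 0 < y a) ∧ (∀ a ∉ U, y a = 0) ∧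
      ∃ c, ∀ b ∈ V, ∑ a, y a * A a b = c := by
  classical
  -- Vectors that agree on `U` with some `A p`, where `p` has sum zero and support in `V`. Their
  -- coordinates outside `U` are free, which later forces the separating functional to vanish there.
  let L : Submodule ℝ (S₁ → ℝ) :=
    { carrier := {v | ∃ p : S₂ → ℝ, (∀ b ∉ V, p b = 0) ∧ ∑ b, p b = 0 ∧
        ∀ a ∈ U, v a = ∑ b, A a b * p b}
      zero_mem' := ⟨0, by simp⟩
      add_mem' := by
        rintro v w ⟨p, h1, h2, h3⟩ ⟨q, g1, g2, g3⟩
        refine ⟨p + q, fun b hb => by simp [h1 b hb, g1 b hb], ?_, fun a ha => ?_⟩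
        · simp [Finset.sum_add_distrib, h2, g2]
        · simp [mul_add, Finset.sum_add_distrib, h3 a ha, g3 a ha]
      smul_mem' := by
        rintro c v ⟨p, h1, h2, h3⟩
        refine ⟨c • p, fun b hb => by simp [h1 b hb], ?_, fun a ha => ?_⟩
        · simp [← Finset.mul_sum, h2]
        · simp only [Pi.smul_apply, smul_eq_mul, h3 a ha, Finset.mul_sum]
          exact Finset.sum_congr rfl fun b _ => by ring }
  let K : Set (S₁ → ℝ) := stdSimplex ℝ S₁ ∩ {v | ∀ a ∉ U, v a = 0}
  by_cases hdisj : Disjoint K (L : Set (S₁ → ℝ))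
  · right
    have hKconv : Convex ℝ K := (convex_stdSimplex ℝ S₁).inter fun v hv w hw s t _ _ _ a ha => by
      simp [hv a ha, hw a ha]
    have hKcpt : IsCompact K := (isCompact_stdSimplex ℝ S₁).inter_right (by
      simp only [Set.ofPred_forall]
      exact isClosed_iInter fun a => isClosed_iInter fun _ =>
        isClosed_eq (continuous_apply a) continuous_const)
    obtain ⟨f, u, v, hfK, huv, hfL⟩ := geometric_hahn_banach_compact_closed hKconv hKcpt
      L.convex L.closed_of_finiteDimensional hdisj
    have hv0 : v < 0 := by simpa using hfL 0 L.zero_mem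
    -- A linear functional bounded below on a subspace vanishes on it. It is therefore negative on
    -- `K`, and minus its coordinates form the equalizer.
    have hf0 : ∀ w ∈ L, f w = 0 := by
      intro w hw
      by_contra hne
      have := hfL ((v / f w) • w) (L.smul_mem _ hw)
      rw [map_smul, smul_eq_mul, div_mul_cancel₀ _ hne] at this
      exact lt_irrefl _ this
    have hfe : ∀ w : S₁ → ℝ, f w = ∑ a, w a * f (Pi.single a 1) := fun w => by
      conv_lhs => rw [pi_eq_sum_univ' w, map_sum]
      simp [map_smul, Pi.single]
    refine ⟨fun a => -f (Pi.single a 1), fun a ha => ?_, fun a ha => ?_, ?_⟩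
    · have : f (Pi.single a 1) < u := by
        refine hfK _ ⟨single_mem_stdSimplex ℝ a, fun a' ha' => ?_⟩
        rw [Pi.single_eq_of_ne]
        rintro rfl
        exact ha' ha
      linarith
    · refine neg_eq_zero.2 (hf0 _ ?_)
      refine ⟨0, by simp, by simp, fun a' ha' => ?_⟩
      rw [Pi.single_eq_of_ne]
      · simp
      · rintro rfl
        exact ha ha'
    · rcases V.eq_empty_or_nonempty with rfl | ⟨b₀, hb₀⟩
      · exact ⟨0, by simp⟩
      refine ⟨∑ a, -f (Pi.single a 1) * A a b₀, fun b hb => ?_⟩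
      -- Differences of two columns from `V` lie in `L`, so the functional takes the same value on
      -- all these columns.
      have h := hf0 (fun a => A a b - A a b₀) ⟨Pi.single b 1 - Pi.single b₀ 1, ?_, ?_, ?_⟩
      · rw [hfe] at h
        rw [← sub_eq_zero, ← Finset.sum_sub_distrib, ← neg_eq_zero, ← h, ← Finset.sum_neg_distrib]
        exact Finset.sum_congr rfl fun a _ => by ring
      · intro b' hb'
        rw [Pi.sub_apply, Pi.single_eq_of_ne, Pi.single_eq_of_ne, sub_zero]
        · rintro rfl; exact hb' hb₀
        · rintro rfl; exact hb' hb
      · simp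
      · intro a _
        simp [mul_sub, Finset.sum_sub_distrib, Pi.single_apply]
  · left
    obtain ⟨w, ⟨⟨hw0, hw1⟩, hwU⟩, p, h1, h2, h3⟩ := Set.not_disjoint_iff.1 hdisj
    refine ⟨p, h1, h2, fun a ha => h3 a ha ▸ hw0 a, ?_⟩
    obtain ⟨a, -, ha⟩ := Finset.exists_ne_zero_of_sum_ne_zero (hw1.trans_ne one_ne_zero)
    have haU : a ∈ U := by
      by_contra h
      exact ha (hwU a h)
    exact ⟨a, haU, h3 a haU ▸ (hw0 a).lt_of_ne' ha⟩

/-! ### Jensen's inequality for log-sum-exp, with strictness -/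

theorem sum_mul_le_log_sum_exp {S : Type*} [Fintype S] (w : S → ℝ) (x : stdSimplex ℝ S) :
    ∑ a, x a * w a ≤ Real.log (∑ a, x a * Real.exp (w a)) := by
  rw [Real.le_log_iff_exp_le (mwu_denom_pos w x)]
  have h := convexOn_exp.map_sum_le (t := Finset.univ) (w := x) (p := w) (fun a _ => x.2.1 a) x.2.2
    (fun _ _ => Set.mem_univ _)
  simpa using h

/-- After centring at the mean `m`, the bound is the average of `1 + t ≤ exp t`, which is strict for
`t ≠ 0`. Of two distinct values in the support, at least one differs from `m`. -/
theorem sum_mul_lt_log_sum_exp {S : Type*} [Fintype S] (w : S → ℝ) (x : stdSimplex ℝ S) {a b : S}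
    (ha : 0 < x a) (hb : 0 < x b) (hab : w a ≠ w b) :
    ∑ a, x a * w a < Real.log (∑ a, x a * Real.exp (w a)) := by
  have h1 : ∑ a, x a = 1 := x.2.2
  rw [Real.lt_log_iff_exp_lt (mwu_denom_pos w x)]
  set m := ∑ a, x a * w a with hm
  obtain ⟨c, hc, hcm⟩ : ∃ c, 0 < x c ∧ w c ≠ m := by
    by_cases h : w a = m
    · exact ⟨b, hb, fun h' => hab (h.trans h'.symm)⟩
    · exact ⟨a, ha, h⟩
  have hlt : ∑ a, x a * (w a - m + 1) < ∑ a, x a * Real.exp (w a - m) := by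
    refine Finset.sum_lt_sum
      (fun i _ => mul_le_mul_of_nonneg_left (Real.add_one_le_exp _) (x.2.1 i))
      ⟨c, Finset.mem_univ _, mul_lt_mul_of_pos_left (Real.add_one_lt_exp (sub_ne_zero.2 hcm)) hc⟩
  have h2 : ∑ a, x a * (w a - m + 1) = 1 := by
    simp only [mul_add, mul_sub, Finset.sum_add_distrib, Finset.sum_sub_distrib, ← Finset.sum_mul,
      h1, ← hm]
    ring
  calc Real.exp m = Real.exp m * 1 := (mul_one _).symm
    _ < Real.exp m * ∑ a, x a * Real.exp (w a - m) :=
        mul_lt_mul_of_pos_left (h2 ▸ hlt) (Real.exp_pos _)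
    _ = ∑ a, x a * Real.exp (w a) := by
        rw [Finset.mul_sum]
        refine Finset.sum_congr rfl fun a _ => ?_
        rw [Real.exp_sub]
        field_simp

theorem sum_sum_mul_le_sum_log_sum_exp {S T : Type*} [Fintype S] [Fintype T] (w : S → T → ℝ)
    (x : stdSimplex ℝ S) (y : stdSimplex ℝ T) :
    ∑ b, y b * ∑ a, x a * w a b ≤ ∑ b, y b * Real.log (∑ a, x a * Real.exp (w a b)) :=
  Finset.sum_le_sum fun b _ =>
    mul_le_mul_of_nonneg_left (sum_mul_le_log_sum_exp (fun a => w a b) x) (y.2.1 b)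

theorem sum_sum_mul_lt_sum_log_sum_exp {S T : Type*} [Fintype S] [Fintype T] (w : S → T → ℝ)
    (x : stdSimplex ℝ S) (y : stdSimplex ℝ T) {a a' : S} (ha : 0 < x a) (ha' : 0 < x a')
    (hw : ∀ b, w a b ≠ w a' b) :
    ∑ b, y b * ∑ a, x a * w a b < ∑ b, y b * Real.log (∑ a, x a * Real.exp (w a b)) := by
  have h1 : ∑ b, y b = 1 := y.2.2
  obtain ⟨b, -, hb⟩ := Finset.exists_ne_zero_of_sum_ne_zero (h1.trans_ne one_ne_zero)
  have hb' : 0 < y b := (y.2.1 b).lt_of_ne' hb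
  exact Finset.sum_lt_sum (fun b _ =>
    mul_le_mul_of_nonneg_left (sum_mul_le_log_sum_exp (fun a => w a b) x) (y.2.1 b))
    ⟨b, Finset.mem_univ _, mul_lt_mul_of_pos_left
      (sum_mul_lt_log_sum_exp (fun a => w a b) x ha ha' (hw b)) hb'⟩

/-! ### Invariant measures and open faces -/

section Face

theorem mwuStep_apply {S : Type*} [Fintype S] (η : ℝ) (u : S → ℝ) (x : stdSimplex ℝ S) (a : S) :
    mwuStep η u x a = x a * Real.exp (η * u a) / ∑ b, x b * Real.exp (η * u b) := rfl

theorem mwuStep_pos_iff {S : Type*} [Fintype S] (η : ℝ) (u : S → ℝ) (x : stdSimplex ℝ S) (a : S) :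
    0 < mwuStep η u x a ↔ 0 < x a := by
  rw [mwuStep_apply, div_pos_iff_of_pos_right (mwu_denom_pos (fun a => η * u a) x),
    mul_pos_iff_of_pos_right (Real.exp_pos _)]

theorem log_mwuStep {S : Type*} [Fintype S] (η : ℝ) (u : S → ℝ) (x : stdSimplex ℝ S) {a : S}
    (ha : 0 < x a) :
    Real.log (mwuStep η u x a) =
      Real.log (x a) + (η * u a - Real.log (∑ b, x b * Real.exp (η * u b))) := by
  rw [mwuStep_apply, Real.log_div (mul_pos ha (Real.exp_pos _)).ne'
    (mwu_denom_pos (fun a => η * u a) x).ne', Real.log_mul ha.ne' (Real.exp_pos _).ne',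
    Real.log_exp]
  ring

theorem continuous_log_mwu_denom {S : Type*} [Fintype S] (w : S → ℝ) :
    Continuous fun x : stdSimplex ℝ S => Real.log (∑ b, x b * Real.exp (w b)) :=
  (continuous_finsetSum _ fun b _ => (continuous_coord b).mul continuous_const).log
    fun x => (mwu_denom_pos w x).ne'

variable {S₁ S₂ : Type*} [Fintype S₁] [Fintype S₂] (A : Matrix S₁ S₂ ℝ) (η₁ η₂ : ℝ)

/-- The profiles whose supports are exactly `U` and `V`. -/
def openFace (U : Finset S₁) (V : Finset S₂) : Set (MixedProfile S₁ S₂) :=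
  {x | (∀ a, 0 < x.1 a ↔ a ∈ U) ∧ ∀ b, 0 < x.2 b ↔ b ∈ V}

theorem measurableSet_openFace (U : Finset S₁) (V : Finset S₂) :
    MeasurableSet (openFace U V) := by
  have h1 : ∀ a, Measurable fun x : MixedProfile S₁ S₂ => x.1 a := fun a =>
    ((continuous_coord a).comp continuous_fst).measurable
  have h2 : ∀ b, Measurable fun x : MixedProfile S₁ S₂ => x.2 b := fun b =>
    ((continuous_coord b).comp continuous_snd).measurable
  have h : openFace U V = (⋂ a, {x : MixedProfile S₁ S₂ | 0 < x.1 a ↔ a ∈ U}) ∩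
      ⋂ b, {x : MixedProfile S₁ S₂ | 0 < x.2 b ↔ b ∈ V} := by
    ext x
    simp [openFace]
  rw [h]
  refine MeasurableSet.inter ?_ ?_
  · exact MeasurableSet.iInter fun a =>
      (measurableSet_lt measurable_const (h1 a)).iff (MeasurableSet.const _)
  · exact MeasurableSet.iInter fun b =>
      (measurableSet_lt measurable_const (h2 b)).iff (MeasurableSet.const _)

theorem mwuUpdate_mem_openFace (U : Finset S₁) (V : Finset S₂) (s : S₁ × S₂)
    (x : MixedProfile S₁ S₂) : mwuUpdate A η₁ η₂ s x ∈ openFace U V ↔ x ∈ openFace U V := by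
  simp only [openFace, mwuUpdate, Set.mem_ofPred_eq, mwuStep_pos_iff]

/-- A weighted sum of logarithms of the coordinates. -/
noncomputable def logSum (p : S₁ → ℝ) (q : S₂ → ℝ) (x : MixedProfile S₁ S₂) : ℝ :=
  ∑ a, p a * Real.log (x.1 a) + ∑ b, q b * Real.log (x.2 b)

/-- The increment of `logSum p q` when the pure profile `s` is drawn from `x`. -/
noncomputable def logSumIncrement (p : S₁ → ℝ) (q : S₂ → ℝ) (s : S₁ × S₂)
    (x : MixedProfile S₁ S₂) : ℝ :=
  ∑ a, p a * (η₁ * A a s.2 - Real.log (∑ a, x.1 a * Real.exp (η₁ * A a s.2))) +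
    ∑ b, q b * (-(η₂ * A s.1 b) - Real.log (∑ b, x.2 b * Real.exp (-(η₂ * A s.1 b))))

theorem measurable_logSum (p : S₁ → ℝ) (q : S₂ → ℝ) : Measurable (logSum p q) := by
  have h1 : ∀ a, Measurable fun x : MixedProfile S₁ S₂ => x.1 a := fun a =>
    ((continuous_coord a).comp continuous_fst).measurable
  have h2 : ∀ b, Measurable fun x : MixedProfile S₁ S₂ => x.2 b := fun b =>
    ((continuous_coord b).comp continuous_snd).measurable
  exact (Finset.measurable_fun_sum _ fun a _ => (h1 a).log.const_mul _).add
    (Finset.measurable_fun_sum _ fun b _ => (h2 b).log.const_mul _)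

/-- `logSum` can be unbounded near the boundary of a face, but the formula for its increments is
continuous on the whole compact space, hence bounded. -/
theorem continuous_logSumIncrement (p : S₁ → ℝ) (q : S₂ → ℝ) (s : S₁ × S₂) :
    Continuous (logSumIncrement A η₁ η₂ p q s) := by
  refine (continuous_finsetSum _ fun a _ => continuous_const.mul (continuous_const.sub ?_)).add
    (continuous_finsetSum _ fun b _ => continuous_const.mul (continuous_const.sub ?_))
  · exact (continuous_log_mwu_denom fun a => η₁ * A a s.2).comp continuous_fst
  · exact (continuous_log_mwu_denom fun b => -(η₂ * A s.1 b)).comp continuous_snd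

variable {A η₁ η₂}

theorem logSum_mwuUpdate_sub {U : Finset S₁} {V : Finset S₂} {p : S₁ → ℝ} {q : S₂ → ℝ}
    (hp : ∀ a ∉ U, p a = 0) (hq : ∀ b ∉ V, q b = 0) (s : S₁ × S₂) {x : MixedProfile S₁ S₂}
    (hx : x ∈ openFace U V) :
    logSum p q (mwuUpdate A η₁ η₂ s x) - logSum p q x = logSumIncrement A η₁ η₂ p q s x := by
  have h1 : ∀ a, p a * Real.log ((mwuUpdate A η₁ η₂ s x).1 a) - p a * Real.log (x.1 a) =
      p a * (η₁ * A a s.2 - Real.log (∑ a, x.1 a * Real.exp (η₁ * A a s.2))) := fun a => by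
    by_cases ha : a ∈ U
    · simp only [mwuUpdate]
      rw [log_mwuStep _ _ _ ((hx.1 a).2 ha)]
      ring
    · simp [hp a ha]
  have h2 : ∀ b, q b * Real.log ((mwuUpdate A η₁ η₂ s x).2 b) - q b * Real.log (x.2 b) =
      q b * (-(η₂ * A s.1 b) - Real.log (∑ b, x.2 b * Real.exp (-(η₂ * A s.1 b)))) := fun b => by
    by_cases hb : b ∈ V
    · simp only [mwuUpdate]
      rw [log_mwuStep _ _ _ ((hx.2 b).2 hb)]
      simp only [Matrix.neg_apply, Matrix.transpose_apply, mul_neg]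
      ring
    · simp [hq b hb]
  simp only [logSum, logSumIncrement, ← h1, ← h2, Finset.sum_sub_distrib]
  ring

/-- Agent 1's increment depends only on `s.2` and agent 2's only on `s.1`, so each averages against
one marginal. If `p` or `q` sums to zero, the corresponding log-normalizers disappear. -/
theorem sum_weight_mul_logSumIncrement (p : S₁ → ℝ) (q : S₂ → ℝ) (x : MixedProfile S₁ S₂) :
    ∑ s : S₁ × S₂, x.1 s.1 * x.2 s.2 * logSumIncrement A η₁ η₂ p q s x =
      (η₁ * ∑ b, x.2 b * (∑ a, p a * A a b) -
        (∑ a, p a) * ∑ b, x.2 b * Real.log (∑ a, x.1 a * Real.exp (η₁ * A a b))) -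
      (η₂ * ∑ a, x.1 a * (∑ b, A a b * q b) +
        (∑ b, q b) * ∑ a, x.1 a * Real.log (∑ b, x.2 b * Real.exp (-(η₂ * A a b)))) := by
  have h1 : ∑ a, x.1 a = 1 := x.1.2.2
  have h2 : ∑ b, x.2 b = 1 := x.2.2.2
  have key : ∀ (F : S₂ → ℝ) (G : S₁ → ℝ), ∑ s : S₁ × S₂, x.1 s.1 * x.2 s.2 * (F s.2 + G s.1) =
      ∑ b, x.2 b * F b + ∑ a, x.1 a * G a := fun F G => by
    have e1 : ∑ s : S₁ × S₂, x.1 s.1 * x.2 s.2 * F s.2 = ∑ b, x.2 b * F b := by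
      rw [Fintype.sum_prod_type]
      simp only [mul_assoc, ← Finset.mul_sum, ← Finset.sum_mul, h1, one_mul]
    have e2 : ∑ s : S₁ × S₂, x.1 s.1 * x.2 s.2 * G s.1 = ∑ a, x.1 a * G a := by
      rw [Fintype.sum_prod_type]
      simp only [mul_right_comm _ _ (G _), ← Finset.mul_sum, h2, mul_one]
    simp only [mul_add, Finset.sum_add_distrib, e1, e2]
  simp only [logSumIncrement]
  rw [key (fun b => ∑ a, p a * (η₁ * A a b - Real.log (∑ a, x.1 a * Real.exp (η₁ * A a b))))
    (fun a => ∑ b, q b * (-(η₂ * A a b) - Real.log (∑ b, x.2 b * Real.exp (-(η₂ * A a b)))))]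
  have e3 : ∀ b, ∑ a, p a * (η₁ * A a b - Real.log (∑ a, x.1 a * Real.exp (η₁ * A a b))) =
      η₁ * (∑ a, p a * A a b) -
        (∑ a, p a) * Real.log (∑ a, x.1 a * Real.exp (η₁ * A a b)) := fun b => by
    simp only [mul_sub, Finset.sum_sub_distrib, Finset.sum_mul, Finset.mul_sum, mul_left_comm]
  have e4 : ∀ a, ∑ b, q b * (-(η₂ * A a b) - Real.log (∑ b, x.2 b * Real.exp (-(η₂ * A a b)))) =
      -(η₂ * (∑ b, A a b * q b)) -
        (∑ b, q b) * Real.log (∑ b, x.2 b * Real.exp (-(η₂ * A a b))) := fun a => by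
    simp only [mul_sub, Finset.sum_sub_distrib, Finset.sum_mul, Finset.mul_sum,
      ← Finset.sum_neg_distrib]
    congr 1
    exact Finset.sum_congr rfl fun b _ => by ring
  simp only [e3, e4]
  simp only [mul_sub, mul_neg, Finset.sum_sub_distrib, Finset.sum_neg_distrib,
    mul_left_comm _ η₁ _, mul_left_comm _ η₂ _, mul_left_comm _ (∑ a, p a) _,
    mul_left_comm _ (∑ b, q b) _, ← Finset.mul_sum]
  ring

/-- An open face on which `logSum p q` has positive drift is null for every invariant probability
measure. -/
theorem measure_openFace_eq_zero_of_drift {ν : Measure (MixedProfile S₁ S₂)}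
    [IsProbabilityMeasure ν] (hν : ν.bind (mwuKernel A η₁ η₂) = ν) {U : Finset S₁} {V : Finset S₂}
    {p : S₁ → ℝ} {q : S₂ → ℝ} (hp : ∀ a ∉ U, p a = 0) (hq : ∀ b ∉ V, q b = 0)
    (hpos : ∀ x ∈ openFace U V,
      0 < (η₁ * ∑ b, x.2 b * (∑ a, p a * A a b) -
        (∑ a, p a) * ∑ b, x.2 b * Real.log (∑ a, x.1 a * Real.exp (η₁ * A a b))) -
      (η₂ * ∑ a, x.1 a * (∑ b, A a b * q b) +
        (∑ b, q b) * ∑ a, x.1 a * Real.log (∑ b, x.2 b * Real.exp (-(η₂ * A a b))))) :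
    ν (openFace U V) = 0 := by
  have hb : ∀ s, ∃ C, ∀ x, |logSumIncrement A η₁ η₂ p q s x| ≤ C := fun s => by
    obtain ⟨C, hC⟩ := isCompact_univ.exists_bound_of_continuousOn
      (continuous_logSumIncrement A η₁ η₂ p q s).continuousOn
    exact ⟨C, fun x => hC x (Set.mem_univ x)⟩
  choose C hC using hb
  refine measure_eq_zero_of_drift_pos A η₁ η₂ hν (measurableSet_openFace U V)
    (mwuUpdate_mem_openFace A η₁ η₂ U V) (measurable_logSum p q) (C := ∑ s, C s)
    (fun x hx s => ?_) fun x hx => ?_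
  · rw [logSum_mwuUpdate_sub hp hq s hx]
    exact (hC s x).trans (Finset.single_le_sum (f := C)
      (fun s _ => (abs_nonneg _).trans (hC s x)) (Finset.mem_univ s))
  · have h := hpos x hx
    rw [← sum_weight_mul_logSumIncrement] at h
    simp only [← logSum_mwuUpdate_sub hp hq _ hx, mul_sub, Finset.sum_sub_distrib,
      ← Finset.sum_mul, x.sum_weight, one_mul] at h
    exact h

theorem sum_mul_pos_of_support {S : Type*} [Fintype S] {U : Finset S} {x : stdSimplex ℝ S}
    (hx : ∀ a, 0 < x a ↔ a ∈ U) {v : S → ℝ} (hv : ∀ a ∈ U, 0 ≤ v a) (hv' : ∃ a ∈ U, 0 < v a) :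
    0 < ∑ a, x a * v a := by
  obtain ⟨a, ha, hva⟩ := hv'
  refine Finset.sum_pos' (fun a _ => ?_) ⟨a, Finset.mem_univ a, mul_pos ((hx a).2 ha) hva⟩
  by_cases h : a ∈ U
  · exact mul_nonneg (x.2.1 a) (hv a h)
  · rw [le_antisymm (not_lt.1 fun h' => h ((hx a).1 h')) (x.2.1 a), zero_mul]

theorem sum_mul_eq_of_support {S : Type*} [Fintype S] {U : Finset S} {x : stdSimplex ℝ S}
    (hx : ∀ a, 0 < x a ↔ a ∈ U) {v : S → ℝ} {c : ℝ} (hv : ∀ a ∈ U, v a = c) :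
    ∑ a, x a * v a = c := by
  have h1 : ∑ a, x a = 1 := x.2.2
  calc ∑ a, x a * v a = ∑ a, x a * c := Finset.sum_congr rfl fun a _ => by
        by_cases h : a ∈ U
        · rw [hv a h]
        · rw [le_antisymm (not_lt.1 fun h' => h ((hx a).1 h')) (x.2.1 a), zero_mul, zero_mul]
    _ = c := by rw [← Finset.sum_mul, h1, one_mul]

/-- An invariant probability measure of stochastic MWU gives no mass to an open face that is not a
vertex. -/
theorem measure_openFace_eq_zero (hA : Function.Injective fun s : S₁ × S₂ => A s.1 s.2)
    (hη₁ : 0 < η₁) (hη₂ : 0 < η₂) {ν : Measure (MixedProfile S₁ S₂)}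
    [IsProbabilityMeasure ν] (hν : ν.bind (mwuKernel A η₁ η₂) = ν) {U : Finset S₁} {V : Finset S₂}
    (hUV : U.Nontrivial ∨ V.Nontrivial) : ν (openFace U V) = 0 := by
  rcases (openFace U V).eq_empty_or_nonempty with h | ⟨x₀, hx₀⟩
  · simp [h]
  rcases exists_sum_eq_zero_or_exists_equalizer A U V with
    ⟨q, hqV, hq0, hq, hq'⟩ | ⟨y, hy, hyU, c, hc⟩
  -- The sign of `-q` reflects that agent 2 is paid `-Aᵀ`. The drift is `η₂` times the mean of `A q`
  -- under `x.1`.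
  · refine measure_openFace_eq_zero_of_drift hν (p := 0) (q := -q) (by simp)
      (fun b hb => by simp [hqV b hb]) fun x hx => ?_
    have h := mul_pos hη₂ (sum_mul_pos_of_support hx.1 hq hq')
    simpa [hq0] using h
  rcases exists_sum_eq_zero_or_exists_equalizer A.transpose V U with
    ⟨p, hpU, hp0, hp, hp'⟩ | ⟨z, hz, hzV, d, hd⟩
  · simp only [Matrix.transpose_apply, mul_comm (A _ _)] at hp hp'
    refine measure_openFace_eq_zero_of_drift hν (p := p) (q := 0) hpU (by simp) fun x hx => ?_
    have h := mul_pos hη₁ (sum_mul_pos_of_support hx.2 hp hp')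
    simpa [hp0] using h
  simp only [Matrix.transpose_apply] at hd
  have hY : 0 < ∑ a, y a := by
    have h1 : ∑ a, x₀.1 a = 1 := x₀.1.2.2
    obtain ⟨a, -, ha⟩ := Finset.exists_ne_zero_of_sum_ne_zero (h1.trans_ne one_ne_zero)
    have haU := (hx₀.1 a).1 ((x₀.1.2.1 a).lt_of_ne' ha)
    refine Finset.sum_pos' (fun a _ => ?_) ⟨a, Finset.mem_univ a, hy a haU⟩
    by_cases h : a ∈ U
    · exact (hy a h).le
    · exact (hyU a h).ge
  have hZ : 0 < ∑ b, z b := by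
    have h1 : ∑ b, x₀.2 b = 1 := x₀.2.2.2
    obtain ⟨b, -, hb⟩ := Finset.exists_ne_zero_of_sum_ne_zero (h1.trans_ne one_ne_zero)
    have hbV := (hx₀.2 b).1 ((x₀.2.2.1 b).lt_of_ne' hb)
    refine Finset.sum_pos' (fun b _ => ?_) ⟨b, Finset.mem_univ b, hz b hbV⟩
    by_cases h : b ∈ V
    · exact (hz b h).le
    · exact (hzV b h).ge
  set Y := ∑ a, y a with hYdef
  set Z := ∑ b, z b with hZdef
  -- Both sides compute `yᵀ A z`. After normalization, the two equalizers thus give the same value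
  -- of the subgame.
  have hcd : c * Z = d * Y := by
    have e1 : ∑ b, ∑ a, y a * A a b * z b = c * Z := by
      rw [hZdef, Finset.mul_sum]
      refine Finset.sum_congr rfl fun b _ => ?_
      rw [← Finset.sum_mul]
      by_cases h : b ∈ V
      · rw [hc b h]
      · rw [hzV b h, mul_zero, mul_zero]
    have e2 : ∑ a, ∑ b, y a * A a b * z b = d * Y := by
      rw [hYdef, Finset.mul_sum]
      refine Finset.sum_congr rfl fun a _ => ?_
      by_cases h : a ∈ U
      · rw [← hd a h, Finset.sum_mul]
        exact Finset.sum_congr rfl fun b _ => by ring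
      · simp [hyU a h]
    rw [← e1, ← e2, Finset.sum_comm]
  have hcd' : c / Y = d / Z := by
    rw [div_eq_div_iff hY.ne' hZ.ne', hcd]
  -- Cross-entropies relative to the equilibrium `(y / Y, z / Z)`. Dividing by the rates makes the
  -- two payoff contributions exact opposites, even for unequal rates.
  refine measure_openFace_eq_zero_of_drift hν (p := fun a => -(y a / Y) / η₁)
    (q := fun b => -(z b / Z) / η₂) (fun a ha => by simp [hyU a ha])
    (fun b hb => by simp [hzV b hb]) fun x hx => ?_
  have e1 : ∑ b, x.2 b * (∑ a, -(y a / Y) / η₁ * A a b) = -(c / Y) / η₁ :=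
    sum_mul_eq_of_support hx.2 fun b hb => by
      rw [← hc b hb, Finset.sum_div, ← Finset.sum_neg_distrib, Finset.sum_div]
      exact Finset.sum_congr rfl fun a _ => by ring
  have e2 : ∑ a, x.1 a * (∑ b, A a b * (-(z b / Z) / η₂)) = -(d / Z) / η₂ :=
    sum_mul_eq_of_support hx.1 fun a ha => by
      rw [← hd a ha, Finset.sum_div, ← Finset.sum_neg_distrib, Finset.sum_div]
      exact Finset.sum_congr rfl fun a _ => by ring
  have e3 : ∑ a, -(y a / Y) / η₁ = -1 / η₁ := by
    rw [← Finset.sum_div, Finset.sum_neg_distrib, ← Finset.sum_div, ← hYdef, div_self hY.ne']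
  have e4 : ∑ b, -(z b / Z) / η₂ = -1 / η₂ := by
    rw [← Finset.sum_div, Finset.sum_neg_distrib, ← Finset.sum_div, ← hZdef, div_self hZ.ne']
  rw [e1, e2, e3, e4]
  set L₁ := ∑ b, x.2 b * Real.log (∑ a, x.1 a * Real.exp (η₁ * A a b)) with hL₁
  set L₂ := ∑ a, x.1 a * Real.log (∑ b, x.2 b * Real.exp (-(η₂ * A a b))) with hL₂
  -- The expected payoff at `x`. Jensen bounds `L₁ / η₁` below by `m` and `L₂ / η₂` by `-m`, and one
  -- of the two bounds is strict on a face that is not a vertex.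
  set m := ∑ b, x.2 b * ∑ a, x.1 a * A a b with hm
  have m1 : ∑ b, x.2 b * ∑ a, x.1 a * (η₁ * A a b) = η₁ * m := by
    simp only [hm, mul_left_comm _ η₁ _, ← Finset.mul_sum]
  have m2 : ∑ a, x.1 a * ∑ b, x.2 b * (-(η₂ * A a b)) = -(η₂ * m) := by
    simp only [hm, mul_neg, Finset.sum_neg_distrib, mul_left_comm _ η₂ _, ← Finset.mul_sum]
    simp only [Finset.mul_sum]
    rw [Finset.sum_comm]
    congr 1
    exact Finset.sum_congr rfl fun b _ => Finset.sum_congr rfl fun a _ => by ring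
  have l1 : η₁ * m ≤ L₁ := m1 ▸ sum_sum_mul_le_sum_log_sum_exp (fun a b => η₁ * A a b) x.1 x.2
  have l2 : -(η₂ * m) ≤ L₂ :=
    m2 ▸ sum_sum_mul_le_sum_log_sum_exp (fun b a => -(η₂ * A a b)) x.2 x.1
  have hgoal : 0 < L₁ / η₁ + L₂ / η₂ := by
    have l1' : m ≤ L₁ / η₁ := by rwa [le_div_iff₀' hη₁]
    have l2' : -m ≤ L₂ / η₂ := by rwa [le_div_iff₀' hη₂, mul_neg]
    rcases hUV with ⟨a, ha, a', ha', hne⟩ | ⟨b, hb, b', hb', hne⟩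
    · have : η₁ * m < L₁ := m1 ▸ sum_sum_mul_lt_sum_log_sum_exp (fun a b => η₁ * A a b) x.1 x.2
        ((hx.1 a).2 ha) ((hx.1 a').2 ha') fun b h =>
          hne (congrArg Prod.fst (@hA (a, b) (a', b) (mul_left_cancel₀ hη₁.ne' h)))
      have : m < L₁ / η₁ := by rwa [lt_div_iff₀' hη₁]
      linarith
    · have : -(η₂ * m) < L₂ :=
        m2 ▸ sum_sum_mul_lt_sum_log_sum_exp (fun b a => -(η₂ * A a b)) x.2 x.1
          ((hx.2 b).2 hb) ((hx.2 b').2 hb') fun a h =>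
          hne (congrArg Prod.snd (@hA (a, b) (a, b') (mul_left_cancel₀ hη₂.ne' (neg_injective h))))
      have : -m < L₂ / η₂ := by rwa [lt_div_iff₀' hη₂, mul_neg]
      linarith
  rw [mul_div_cancel₀ _ hη₁.ne', mul_div_cancel₀ _ hη₂.ne', hcd']
  have : -(d / Z) - -1 / η₁ * L₁ - (-(d / Z) + -1 / η₂ * L₂) = L₁ / η₁ + L₂ / η₂ := by ring
  rwa [this]

end Face

/-! ### Mixtures of pure profiles -/

section Pure

variable {S₁ S₂ : Type*} [Fintype S₁] [Fintype S₂]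

theorem stdSimplex_eq_vertex {S : Type*} [Fintype S] [DecidableEq S] {x : stdSimplex ℝ S} {a : S}
    (h : ∀ b, 0 < x b → b = a) : x = stdSimplex.vertex a := by
  have h0 : ∀ b, b ≠ a → x b = 0 := fun b hb =>
    le_antisymm (not_lt.1 fun h' => hb (h b h')) (x.2.1 b)
  have h1 : ∑ b, x b = 1 := x.2.2
  rw [Finset.sum_eq_single a (fun b _ hb => h0 b hb) (by simp)] at h1
  ext b
  rw [stdSimplex.vertex_coe]
  rcases eq_or_ne b a with rfl | hb
  · simpa using h1
  · simpa [hb] using h0 b hb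

theorem pureProfile_injective : Function.Injective (pureProfile (S₁ := S₁) (S₂ := S₂)) := by
  classical
  intro s t h
  exact Prod.ext (stdSimplex.vertex_injective (congrArg Prod.fst h))
    (stdSimplex.vertex_injective (congrArg Prod.snd h))

/-- The face is the one given by the supports of `x`. Were both supports singletons, `x` would be
pure. -/
theorem exists_nontrivial_openFace_of_notMem_range {x : MixedProfile S₁ S₂}
    (hx : x ∉ Set.range (pureProfile (S₁ := S₁) (S₂ := S₂))) :
    ∃ (U : Finset S₁) (V : Finset S₂), (U.Nontrivial ∨ V.Nontrivial) ∧ x ∈ openFace U V := by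
  classical
  refine ⟨Finset.univ.filter fun a => 0 < x.1 a, Finset.univ.filter fun b => 0 < x.2 b, ?_,
    by simp [openFace]⟩
  by_contra hne
  rw [not_or] at hne
  have h1 : ∑ a, x.1 a = 1 := x.1.2.2
  have h2 : ∑ b, x.2 b = 1 := x.2.2.2
  obtain ⟨a, -, ha⟩ := Finset.exists_ne_zero_of_sum_ne_zero (h1.trans_ne one_ne_zero)
  obtain ⟨b, -, hb⟩ := Finset.exists_ne_zero_of_sum_ne_zero (h2.trans_ne one_ne_zero)
  have ha' : 0 < x.1 a := (x.1.2.1 a).lt_of_ne' ha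
  have hb' : 0 < x.2 b := (x.2.2.1 b).lt_of_ne' hb
  refine hx ⟨(a, b), Prod.ext (stdSimplex_eq_vertex fun a' h => ?_).symm
    (stdSimplex_eq_vertex fun b' h => ?_).symm⟩
  · by_contra hab
    exact hne.1 ⟨a', by simpa using h, a, by simpa using ha', hab⟩
  · by_contra hab
    exact hne.2 ⟨b', by simpa using h, b, by simpa using hb', hab⟩

theorem isMixtureOfPure_of_measure_compl_eq_zero (π : ProbabilityMeasure (MixedProfile S₁ S₂))
    (h : (π : Measure (MixedProfile S₁ S₂))
      (Set.range (pureProfile (S₁ := S₁) (S₂ := S₂)))ᶜ = 0) : IsMixtureOfPure π := by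
  classical
  set ν := (π : Measure (MixedProfile S₁ S₂)) with hν
  have key : ν = ∑ s, (ν {pureProfile s}).toNNReal • Measure.dirac (pureProfile s) := by
    ext B hB
    have h1 : ν B = ν (⋃ s : S₁ × S₂, B ∩ {pureProfile s}) := by
      rw [← Set.inter_iUnion, Set.iUnion_singleton_eq_range]
      exact (measure_inter_conull h).symm
    rw [h1, measure_iUnion, tsum_fintype]
    · simp only [Measure.coe_finsetSum, Finset.sum_apply, Measure.smul_apply]
      refine Finset.sum_congr rfl fun s _ => ?_
      rw [Measure.dirac_apply' _ hB, ENNReal.smul_def, ENNReal.coe_toNNReal (measure_ne_top _ _),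
        smul_eq_mul]
      by_cases hs : pureProfile s ∈ B
      · rw [Set.inter_eq_right.2 (Set.singleton_subset_iff.2 hs)]
        simp [hs]
      · rw [Set.inter_singleton_eq_empty.2 hs]
        simp [hs]
    · intro s t hst
      refine Set.disjoint_left.2 fun x hx hx' => hst (pureProfile_injective ?_)
      rw [← Set.mem_singleton_iff.1 hx.2, ← Set.mem_singleton_iff.1 hx'.2]
    · exact fun s => hB.inter (measurableSet_singleton _)
  refine ⟨fun s => (ν {pureProfile s}).toNNReal, ?_, key⟩
  have h1 := congrArg (fun ρ : Measure (MixedProfile S₁ S₂) => ρ Set.univ) key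
  simp only [hν, measure_univ, Measure.coe_finsetSum, Finset.sum_apply, Measure.smul_apply,
    ENNReal.smul_def, smul_eq_mul, mul_one] at h1
  exact_mod_cast h1.symm

/-- Invariant probability measures of stochastic MWU are mixtures of pure profiles. -/
theorem isMixtureOfPure_of_bind_eq {A : Matrix S₁ S₂ ℝ}
    (hA : Function.Injective fun s : S₁ × S₂ => A s.1 s.2) {η₁ η₂ : ℝ} (hη₁ : 0 < η₁)
    (hη₂ : 0 < η₂) (π : ProbabilityMeasure (MixedProfile S₁ S₂))
    (hπ : (π : Measure (MixedProfile S₁ S₂)).bind (mwuKernel A η₁ η₂) = π) :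
    IsMixtureOfPure π := by
  refine isMixtureOfPure_of_measure_compl_eq_zero π ?_
  refine measure_mono_null (t := ⋃ F : {F : Finset S₁ × Finset S₂ //
    F.1.Nontrivial ∨ F.2.Nontrivial}, openFace F.1.1 F.1.2) (fun x hx => ?_) ?_
  · obtain ⟨U, V, hUV, hxF⟩ := exists_nontrivial_openFace_of_notMem_range hx
    exact Set.mem_iUnion.2 ⟨⟨(U, V), hUV⟩, hxF⟩
  · exact measure_iUnion_null fun F => measure_openFace_eq_zero hA hη₁ hη₂ hπ F.2

end Pure

/-! ### The theorem on time averages -/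

theorem mainTheorem1 {S₁ S₂ : Type*} [Fintype S₁] [Fintype S₂] (A : Matrix S₁ S₂ ℝ)
    (hA : Function.Injective fun s : S₁ × S₂ => A s.1 s.2) :
    ∃ η₀ : ℝ, 0 < η₀ ∧ ∀ η₁ η₂ : ℝ, 0 < η₁ → η₁ < η₀ → 0 < η₂ → η₂ < η₀ →
      ∀ μ : ProbabilityMeasure (MixedProfile S₁ S₂),
        (∃ (φ : ℕ → ℕ+) (π : ProbabilityMeasure (MixedProfile S₁ S₂)), StrictMono φ ∧
          Tendsto (fun n => mwuTimeAverage A η₁ η₂ μ (φ n)) atTop (𝓝 π)) ∧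
        (∀ (φ : ℕ → ℕ+) (π : ProbabilityMeasure (MixedProfile S₁ S₂)), StrictMono φ →
          Tendsto (fun n => mwuTimeAverage A η₁ η₂ μ (φ n)) atTop (𝓝 π) →
          IsMixtureOfPure π) := by
  -- The drift formula is exact rather than an expansion for small rates, so any positive threshold
  -- would serve.
  refine ⟨1, one_pos, fun η₁ η₂ hη₁ _ hη₂ _ μ => ⟨?_, fun φ π hφ h => ?_⟩⟩
  · obtain ⟨π, ψ, hψ, h⟩ := SeqCompactSpace.tendsto_subseq
      fun n : ℕ => mwuTimeAverage A η₁ η₂ μ n.succPNat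
    exact ⟨fun n => (ψ n).succPNat, π, fun a b hab => Nat.succPNat_lt_succPNat.2 (hψ hab), h⟩
  · exact isMixtureOfPure_of_bind_eq hA hη₁ hη₂ π
      (bind_mwuKernel_eq_of_tendsto A η₁ η₂ μ π hφ h)
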